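/- For every $d\in\mathbb N=\{1,2,\dots\}$ let $D_d\subset\mathbb R^d$ be an open set with Lebesgue measure $\lambda_d(D_d)=1$. Let $k\in\{0,1,2,\dots\}$ and let $L=(L_{j,d})_{0\le j\le k,\ d\in\mathbb N}$ be positive real numbers. Let $C_d^k(L)$ be the class of all $f\in C^k(D_d)$ with $|f|\le 1$ on $D_d$ and $$\|f^{(j)}(x)-f^{(j)}(y)\|\le L_{j,d}\,\|x-y\|_2\qquad\text{for all } x,y\in D_d,\ 0\le j\le k,$$ where $f^{(j)}(x)$ is the $j$-th derivative, a $j$-linear form on Euclidean $\mathbb R^d$ with norm $\|A\|=\sup_{\|\theta_i\|_2=1}|A(\theta_1,\dots,\theta_j)|$. Let $\bar C_d^k(L)\subset C_d^k(L)$ be the class of all restrictions $f|_{D_d}$ of functions $f\in C^k(\mathbb R^d)$ that satisfy the same bounds on all of $\mathbb R^d$. For a class $F_d$ of functions on $D_d$ let $n(\varepsilon,F_d)$ be the minimal number $n$ of function values such that some algorithm $A(f)=\phi(f(x_1),\dots,f(x_n))$, with an arbitrary map $\phi:\mathbb R^n\to\mathbb R$ and points $x_i\in D_d$ each of which may depend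 on $f(x_1),\dots,f(x_{i-1})$, satisfies $\sup_{f\in F_d}\left|\int_{D_d}f(x)\,dx-A(f)\right|\le\varepsilon$. Numerical integration over the classes $F_d$ is called uniformly weakly tractable if $$\lim_{d+\varepsilon^{-1}\to\infty}\frac{\ln n(\varepsilon,F_d)}{d^{\alpha}+\varepsilon^{-\alpha}}=0\qquad\text{for all }\alpha\in(0,1),$$ where $d\in\mathbb N$ and $\varepsilon\in(0,1)$ (with $\ln 0$ read as $0$). Suppose that for some real $m<\infty$ $$\limsup_{d\to\infty}\ \min_{0\le j\le k} L_{j,d}\,d^{\,m}>0,$$ that is, there is a constant $c>0$ such that, for infinitely many $d$, $L_{j,d}\ge c\,d^{-m}$ holds for all $j\in\{0,1,\dots,k\}$ simultaneously. Then numerical integration is not uniformly weakly tractable for the classes $\bar C_d^k(L)$, and hence also not for the classes $C_d^k(L)$. -/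

import Mathlib

open Filter Topology MeasureTheory
open scoped ENNReal

/-- An algorithm for functions `f : D → ℝ` that uses `n` function values, chosen adaptively.
`node i` selects the `(i + 1)`-st sample point from the first `i` computed values (only
`i < n` is ever used), and `recon` maps the `n` computed values to the output; both are
arbitrary maps. -/
structure AdaptiveAlgorithm {d : ℕ} (D : Set (EuclideanSpace ℝ (Fin d))) (n : ℕ) where
  node : (i : ℕ) → (Fin i → ℝ) → D
  recon : (Fin n → ℝ) → ℝ

namespace AdaptiveAlgorithm

variable {d n : ℕ} {D : Set (EuclideanSpace ℝ (Fin d))}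

/-- The first `i` function values `(f x₁, …, f xᵢ)` computed by the algorithm on input `f`. -/
def values (A : AdaptiveAlgorithm D n) (f : D → ℝ) : (i : ℕ) → Fin i → ℝ
  | 0 => Fin.elim0
  | i + 1 => Fin.snoc (A.values f i) (f (A.node i (A.values f i)))

/-- The output of the algorithm on input `f`. -/
def output (A : AdaptiveAlgorithm D n) (f : D → ℝ) : ℝ :=
  A.recon (A.values f n)

/-- The worst case error of the algorithm for integration over `D` on the class `F`. -/
noncomputable def error (A : AdaptiveAlgorithm D n) (F : Set (D → ℝ)) : ℝ≥0∞ :=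
  ⨆ f ∈ F, ENNReal.ofReal |(∫ x, f x ∂(volume.comap ((↑) : D → EuclideanSpace ℝ (Fin d)))) - A.output f|

end AdaptiveAlgorithm

/-- The information complexity `n(ε, F)`: the minimal number of function values needed for a
worst case error of at most `ε` (it is `⊤` if no finite number suffices). -/
noncomputable def infoComplexity {d : ℕ} {D : Set (EuclideanSpace ℝ (Fin d))}
    (ε : ℝ) (F : Set (D → ℝ)) : ℕ∞ :=
  ⨅ (n : ℕ) (_ : ∃ A : AdaptiveAlgorithm D n, A.error F ≤ ENNReal.ofReal ε), (n : ℕ∞)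

/-- The class `C_d^k(L)`: functions of class `C^k` on the (open) set `D` that are bounded by `1`
and whose `j`-th derivative is Lipschitz on `D` with constant `L j`, for all `j ≤ k`. The
derivatives are multilinear maps with the operator norm over the Euclidean space, and do not
depend on the values outside `D` of the function `f` that represents the element. -/
def smoothClass {d : ℕ} (D : Set (EuclideanSpace ℝ (Fin d))) (k : ℕ) (L : ℕ → ℝ) :
    Set (D → ℝ) :=
  {g | ∃ f : EuclideanSpace ℝ (Fin d) → ℝ, g = (fun x : D => f x) ∧
    ContDiffOn ℝ k f D ∧ (∀ x ∈ D, |f x| ≤ 1) ∧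
    ∀ j ≤ k, ∀ x ∈ D, ∀ y ∈ D,
      ‖iteratedFDerivWithin ℝ j f D x - iteratedFDerivWithin ℝ j f D y‖ ≤ L j * ‖x - y‖}

/-- The class of restrictions to `D` of the `C^k` functions on the whole of `ℝ^d` that are bounded
by `1` and whose `j`-th derivative is Lipschitz on `ℝ^d` with constant `L j`, for all `j ≤ k`. -/
def smoothClassBar {d : ℕ} (D : Set (EuclideanSpace ℝ (Fin d))) (k : ℕ) (L : ℕ → ℝ) :
    Set (D → ℝ) :=
  {g | ∃ f : EuclideanSpace ℝ (Fin d) → ℝ, g = (fun x : D => f x) ∧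
    ContDiff ℝ k f ∧ (∀ x, |f x| ≤ 1) ∧
    ∀ j ≤ k, ∀ x y,
      ‖iteratedFDeriv ℝ j f x - iteratedFDeriv ℝ j f y‖ ≤ L j * ‖x - y‖}

/-- Uniform weak tractability of a sequence of integration problems on the classes `F d`,
`d = 1, 2, …`: for every `α ∈ (0, 1)`,
`ln n(ε, F d) / (d ^ α + ε ^ (-α)) → 0` as `d + 1 / ε → ∞`, with `ε ∈ (0, 1)`.
For a problem that needs no function value at all, `ln 0` is read as `0`. -/
def UniformlyWeaklyTractable {D : (d : ℕ) → Set (EuclideanSpace ℝ (Fin d))}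
    (F : (d : ℕ) → Set (D d → ℝ)) : Prop :=
  ∀ α : ℝ, 0 < α → α < 1 →
    Tendsto
      (fun p : ℕ × ℝ =>
        ENNReal.log (max 1 (infoComplexity p.2 (F p.1) : ℝ≥0∞)) /
          (((p.1 : ℝ) ^ α + p.2 ^ (-α) : ℝ) : EReal))
      (comap (fun p : ℕ × ℝ => (p.1 : ℝ) + p.2⁻¹) atTop ⊓
        𝓟 {p : ℕ × ℝ | 1 ≤ p.1 ∧ 0 < p.2 ∧ p.2 < 1})
      (𝓝 0)

/-! The proof uses fooling functions. Run an adaptive algorithm on the zero function and let `x i`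
be its `n` nodes. If a smooth `u` with values in `[0, 1]` equals `1` at the nodes and vanishes off
the cubes of side `1/4` around them, then `a (1 - u)` and its negative both yield zero data, so an
error of at most `a / 2` forces `a (1 - n 4^(-d)) ≤ a / 2`, that is `4^d ≤ 2 n`. The cost of
smoothness is only polynomial in `d`: `u` is the indicator of a union of smaller cubes, mollified `k
+ 1` times by a product kernel. Each of up to `k + 1` derivatives falls on its own copy of the
kernel and costs a factor `O(d)` (`exists_smooth_cover`). Hence `a` may be a negative power of `d`,
and at the polynomially small error `a / 2` at least `2^d` values are needed
(`exists_four_pow_le_two_mul`). For small `α` the denominator `d^α + ε^(-α)` is `O(d)`, while `ln n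
≥ d ln 2`. -/

/-! ### Iterated mollification and derivative bounds -/

section Mollify

set_option linter.unusedSectionVars false

open scoped ContDiff Convolution

-- `E` and `G` share a universe so that inductions over `G` can pass to `E →L[ℝ] G`.
universe u

variable {E : Type u} [NormedAddCommGroup E] [NormedSpace ℝ E] [FiniteDimensional ℝ E]
  [MeasurableSpace E] [BorelSpace E]

/-- Convolution with the kernel `φ`. -/
noncomputable def mollify {G : Type u} [NormedAddCommGroup G] [NormedSpace ℝ G]
    (φ : E → ℝ) (μ : Measure E) (g : E → G) : E → G :=
  φ ⋆[ContinuousLinearMap.lsmul ℝ ℝ, μ] g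

/-- A nonnegative smooth compactly supported function of total mass one. -/
structure IsMollifier (φ : E → ℝ) (μ : Measure E) : Prop where
  nonneg : ∀ x, 0 ≤ φ x
  contDiff : ContDiff ℝ ∞ φ
  hasCompactSupport : HasCompactSupport φ
  integral_eq_one : ∫ x, φ x ∂μ = 1

variable {μ : Measure E} {φ : E → ℝ} {G : Type u} [NormedAddCommGroup G] [NormedSpace ℝ G]

theorem mollify_apply (g : E → G) (x : E) :
    mollify φ μ g x = ∫ t, φ t • g (x - t) ∂μ := rfl

variable [μ.IsAddHaarMeasure]

theorem IsMollifier.integrable (hφ : IsMollifier φ μ) : Integrable φ μ :=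
  hφ.contDiff.continuous.integrable_of_hasCompactSupport hφ.hasCompactSupport

theorem norm_mollify_le (hφ : IsMollifier φ μ) {g : E → G} {B : ℝ} (hg : ∀ x, ‖g x‖ ≤ B) (x : E) :
    ‖mollify φ μ g x‖ ≤ B := by
  rw [mollify_apply]
  refine (norm_integral_le_of_norm_le (hφ.integrable.mul_const B) (ae_of_all _ fun t => ?_)).trans
    (by rw [integral_mul_const, hφ.integral_eq_one, one_mul])
  rw [norm_smul, Real.norm_of_nonneg (hφ.nonneg t)]
  exact mul_le_mul_of_nonneg_left (hg _) (hφ.nonneg t)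

theorem contDiff_mollify (hφ : IsMollifier φ μ) {g : E → G} (hg : LocallyIntegrable g μ) :
    ContDiff ℝ ∞ (mollify φ μ g) :=
  hφ.hasCompactSupport.contDiff_convolution_left _ hφ.contDiff hg

theorem hasCompactSupport_mollify (hφ : IsMollifier φ μ) {g : E → G} (hg : HasCompactSupport g) :
    HasCompactSupport (mollify φ μ g) :=
  hφ.hasCompactSupport.convolution _ hg

/-- The derivative is put on the kernel, so `g` need not be continuous; this applies to indicators.
-/
theorem norm_fderiv_mollify_le (hφ : IsMollifier φ μ) {g : E → G} (hg : LocallyIntegrable g μ)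
    {B : ℝ} (hB : ∀ x, ‖g x‖ ≤ B) (x : E) :
    ‖fderiv ℝ (mollify φ μ g) x‖ ≤ (∫ t, ‖fderiv ℝ φ t‖ ∂μ) * B := by
  have hφ1 : ContDiff ℝ 1 φ := hφ.contDiff.of_le (by exact_mod_cast le_top)
  have h := hφ.hasCompactSupport.hasFDerivAt_convolution_left
    (ContinuousLinearMap.lsmul ℝ ℝ) hφ1 hg x
  have hi : Integrable (fun t => ‖fderiv ℝ φ t‖) μ :=
    ((hφ1.continuous_fderiv one_ne_zero).integrable_of_hasCompactSupport
      (hφ.hasCompactSupport.fderiv ℝ)).norm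
  rw [mollify, h.fderiv, convolution_def]
  refine (norm_integral_le_of_norm_le (hi.mul_const B) (ae_of_all _ fun t => ?_)).trans
    (by rw [integral_mul_const])
  have hB0 : 0 ≤ B := (norm_nonneg _).trans (hB x)
  refine ContinuousLinearMap.opNorm_le_bound _ (by positivity) fun v => ?_
  rw [ContinuousLinearMap.precompL_apply, ContinuousLinearMap.lsmul_apply, norm_smul]
  calc _ ≤ (‖fderiv ℝ φ t‖ * ‖v‖) * B :=
        mul_le_mul (ContinuousLinearMap.le_opNorm _ _) (hB _) (norm_nonneg _) (by positivity)
    _ = _ := by ring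

theorem fderiv_mollify (hφ : IsMollifier φ μ) {g : E → G} (hg : ContDiff ℝ ∞ g)
    (hgs : HasCompactSupport g) :
    fderiv ℝ (mollify φ μ g) = mollify φ μ (fderiv ℝ g) := by
  ext1 x
  exact (hgs.hasFDerivAt_convolution_right (ContinuousLinearMap.lsmul ℝ ℝ)
    hφ.integrable.locallyIntegrable (hg.of_le (by exact_mod_cast le_top)) x).fderiv

theorem contDiff_iterate_mollify (hφ : IsMollifier φ μ) {g : E → G} (hg : ContDiff ℝ ∞ g)
    (j : ℕ) : ContDiff ℝ ∞ ((mollify φ μ)^[j] g) := by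
  induction j generalizing g with
  | zero => exact hg
  | succ j ih => exact ih (contDiff_mollify hφ hg.continuous.locallyIntegrable)

theorem fderiv_iterate_mollify (hφ : IsMollifier φ μ) {g : E → G} (hg : ContDiff ℝ ∞ g)
    (hgs : HasCompactSupport g) (j : ℕ) :
    fderiv ℝ ((mollify φ μ)^[j] g) = (mollify φ μ)^[j] (fderiv ℝ g) := by
  induction j generalizing g with
  | zero => rfl
  | succ j ih =>
    rw [Function.iterate_succ_apply, Function.iterate_succ_apply,
      ih (contDiff_mollify hφ hg.continuous.locallyIntegrable) (hasCompactSupport_mollify hφ hgs),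
      fderiv_mollify hφ hg hgs]

theorem norm_iterate_mollify_le (hφ : IsMollifier φ μ) {g : E → G} {B : ℝ}
    (hg : ∀ x, ‖g x‖ ≤ B) (j : ℕ) (x : E) : ‖(mollify φ μ)^[j] g x‖ ≤ B := by
  induction j generalizing g with
  | zero => exact hg x
  | succ j ih => exact ih (norm_mollify_le hφ hg)

/-- One derivative is spent on the innermost kernel and commutes with the outer mollifications; the
rest is induction with `fderiv` of the mollified function in place of `g`. Hence `i ≤ j` and the
variable codomain. -/
theorem norm_iteratedFDeriv_iterate_mollify_le (hφ : IsMollifier φ μ) (i : ℕ) :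
    ∀ {G : Type u} [NormedAddCommGroup G] [NormedSpace ℝ G] {g : E → G} {B : ℝ} {j : ℕ},
      LocallyIntegrable g μ → HasCompactSupport g → (∀ x, ‖g x‖ ≤ B) → i ≤ j → ∀ x,
      ‖iteratedFDeriv ℝ i ((mollify φ μ)^[j] g) x‖ ≤ (∫ t, ‖fderiv ℝ φ t‖ ∂μ) ^ i * B := by
  induction i with
  | zero =>
    intro G _ _ g B j hg hgs hB _ x
    rw [norm_iteratedFDeriv_zero, pow_zero, one_mul]
    exact norm_iterate_mollify_le hφ hB j x
  | succ i ih =>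
    intro G _ _ g B j hg hgs hB hij x
    obtain ⟨j, rfl⟩ : ∃ l, j = l + 1 := ⟨j - 1, by omega⟩
    have hsm := contDiff_mollify hφ hg
    rw [← norm_iteratedFDeriv_fderiv, Function.iterate_succ_apply,
      fderiv_iterate_mollify hφ hsm (hasCompactSupport_mollify hφ hgs), pow_succ, mul_assoc]
    exact ih (hsm.continuous_fderiv (by simp)).locallyIntegrable
      ((hasCompactSupport_mollify hφ hgs).fderiv ℝ) (norm_fderiv_mollify_le hφ hg hB) (by omega) x

end Mollify

/-! ### Cubes and product kernels -/

section Cube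

open scoped ContDiff

variable {d : ℕ}

/-- The closed axis-parallel cube with center `x` and side length `2 * r`. -/
def cube (x : EuclideanSpace ℝ (Fin d)) (r : ℝ) : Set (EuclideanSpace ℝ (Fin d)) :=
  {y | ∀ l, |y l - x l| ≤ r}

theorem cube_eq_preimage (x : EuclideanSpace ℝ (Fin d)) (r : ℝ) :
    cube x r = WithLp.ofLp ⁻¹' (Set.Icc (fun l => x l - r) (fun l => x l + r)) := by
  ext y
  simp only [cube, Set.mem_ofPred_eq, Set.mem_preimage, Set.mem_Icc, Pi.le_def, abs_le]
  exact ⟨fun h => ⟨fun l => by linarith [(h l).1], fun l => by linarith [(h l).2]⟩,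
    fun h l => ⟨by linarith [h.1 l], by linarith [h.2 l]⟩⟩

theorem isClosed_cube (x : EuclideanSpace ℝ (Fin d)) (r : ℝ) : IsClosed (cube x r) := by
  rw [cube_eq_preimage]
  exact isClosed_Icc.preimage (PiLp.continuous_ofLp 2 _)

theorem isCompact_cube (x : EuclideanSpace ℝ (Fin d)) (r : ℝ) : IsCompact (cube x r) := by
  rw [cube_eq_preimage]
  exact (PiLp.homeomorph 2 fun _ : Fin d => ℝ).isCompact_preimage.2 isCompact_Icc

theorem volume_cube (x : EuclideanSpace ℝ (Fin d)) (r : ℝ) :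
    volume (cube x r) = ENNReal.ofReal (2 * r) ^ d := by
  rw [cube_eq_preimage, (PiLp.volume_preserving_ofLp (Fin d)).measure_preimage
    measurableSet_Icc.nullMeasurableSet, Real.volume_Icc_pi]
  simp [show ∀ a : ℝ, a + r - (a - r) = 2 * r from fun a => by ring]

/-- The product kernel `x ↦ ∏ l, η (x l)`. -/
noncomputable def productKernel (d : ℕ) (η : ℝ → ℝ) (x : EuclideanSpace ℝ (Fin d)) : ℝ :=
  ∏ l, η (x l)

theorem contDiff_productKernel {η : ℝ → ℝ} (hη : ContDiff ℝ ∞ η) :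
    ContDiff ℝ ∞ (productKernel d η) := by
  unfold productKernel
  refine contDiff_prod fun l _ => hη.comp ?_
  fun_prop

theorem integral_prod_coord (f : Fin d → ℝ → ℝ) :
    ∫ x : EuclideanSpace ℝ (Fin d), ∏ l, f l (x l) = ∏ l, ∫ t, f l t := by
  rw [← integral_fintype_prod_volume_eq_prod]
  exact (PiLp.volume_preserving_ofLp (Fin d)).integral_comp
    (MeasurableEquiv.toLp 2 (Fin d → ℝ)).symm.measurableEmbedding (fun y => ∏ l, f l (y l))

theorem integrable_prod_coord {f : Fin d → ℝ → ℝ} (hf : ∀ l, Integrable (f l)) :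
    Integrable fun x : EuclideanSpace ℝ (Fin d) => ∏ l, f l (x l) :=
  (PiLp.volume_preserving_ofLp (Fin d)).integrable_comp_of_integrable (Integrable.fintype_prod hf)

theorem productKernel_support {η : ℝ → ℝ} {h : ℝ} (hη : ∀ t, η t ≠ 0 → |t| ≤ h)
    {x : EuclideanSpace ℝ (Fin d)} (hx : productKernel d η x ≠ 0) (l : Fin d) : |x l| ≤ h :=
  hη _ (Finset.prod_ne_zero_iff.1 hx l (Finset.mem_univ l))

theorem isMollifier_productKernel {η : ℝ → ℝ} {h : ℝ} (h0 : ∀ t, 0 ≤ η t) (hs : ContDiff ℝ ∞ η)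
    (hη : ∀ t, η t ≠ 0 → |t| ≤ h) (h1 : ∫ t, η t = 1) :
    IsMollifier (productKernel d η) volume where
  nonneg x := Finset.prod_nonneg fun l _ => h0 _
  contDiff := contDiff_productKernel hs
  hasCompactSupport := HasCompactSupport.intro (isCompact_cube 0 h) fun x hx => by
    by_contra hne
    exact hx fun l => by simpa using productKernel_support hη hne l
  integral_eq_one := by
    unfold productKernel
    rw [integral_prod_coord]
    simp [h1]

/-- Product rule and triangle inequality. Every summand is again a product over coordinates, so
Fubini integrates it exactly. -/
theorem norm_fderiv_productKernel_le {η : ℝ → ℝ} (h0 : ∀ t, 0 ≤ η t) (hs : ContDiff ℝ ∞ η)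
    (x : EuclideanSpace ℝ (Fin d)) :
    ‖fderiv ℝ (productKernel d η) x‖ ≤
      ∑ i, ∏ l, (if l = i then fun t => |deriv η t| else η) (x l) := by
  have hd : ∀ i ∈ (Finset.univ : Finset (Fin d)),
      HasFDerivAt (fun y : EuclideanSpace ℝ (Fin d) => η (y i))
        (deriv η (x i) • EuclideanSpace.proj (𝕜 := ℝ) i) x := fun i _ =>
    ((hs.differentiable (by simp)) (x i)).hasDerivAt.comp_hasFDerivAt x
      (EuclideanSpace.proj (𝕜 := ℝ) i).hasFDerivAt
  have hp := HasFDerivAt.finsetProd hd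
  rw [show fderiv ℝ (productKernel d η) x = _ from hp.fderiv]
  refine (norm_sum_le _ _).trans (Finset.sum_le_sum fun i _ => ?_)
  have he : ∏ l ∈ Finset.univ.erase i, (if l = i then fun t => |deriv η t| else η) (x l) =
      ∏ l ∈ Finset.univ.erase i, η (x l) :=
    Finset.prod_congr rfl fun l hl => by rw [if_neg (Finset.ne_of_mem_erase hl)]
  rw [norm_smul, norm_smul, ← Finset.mul_prod_erase _ _ (Finset.mem_univ i), if_pos rfl, he,
    Real.norm_of_nonneg (Finset.prod_nonneg fun l _ => h0 _), mul_comm, Real.norm_eq_abs]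
  refine mul_le_mul_of_nonneg_right ?_ (Finset.prod_nonneg fun l _ => h0 _)
  refine mul_le_of_le_one_right (abs_nonneg _) ?_
  refine ContinuousLinearMap.opNorm_le_bound _ zero_le_one fun v => ?_
  rw [one_mul]
  exact PiLp.norm_apply_le v i

theorem integral_norm_fderiv_productKernel_le {η : ℝ → ℝ} {h : ℝ} (h0 : ∀ t, 0 ≤ η t)
    (hs : ContDiff ℝ ∞ η) (hη : ∀ t, η t ≠ 0 → |t| ≤ h) (h1 : ∫ t, η t = 1) :
    ∫ x, ‖fderiv ℝ (productKernel d η) x‖ ≤ d * ∫ t, |deriv η t| := by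
  have hc : HasCompactSupport η := HasCompactSupport.intro (isCompact_Icc (a := -h) (b := h))
    fun t ht => by
      by_contra hne
      exact ht (abs_le.1 (hη t hne))
  have hi : Integrable η := hs.continuous.integrable_of_hasCompactSupport hc
  have hi' : Integrable fun t => |deriv η t| :=
    ((hs.continuous_deriv (by simp)).integrable_of_hasCompactSupport hc.deriv).norm
  have hI : ∀ i : Fin d, Integrable fun x : EuclideanSpace ℝ (Fin d) =>
      ∏ l, (if l = i then fun t => |deriv η t| else η) (x l) := fun i =>
    integrable_prod_coord fun l => by split_ifs <;> assumption
  refine (integral_mono_of_nonneg (ae_of_all _ fun _ => norm_nonneg _)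
    (integrable_finsetSum _ fun i _ => hI i)
    (ae_of_all _ (norm_fderiv_productKernel_le h0 hs))).trans ?_
  rw [integral_finsetSum _ fun i _ => hI i]
  refine (Finset.sum_le_card_nsmul _ _ (∫ t, |deriv η t|) fun i _ => ?_).trans (by simp)
  rw [integral_prod_coord, ← Finset.mul_prod_erase _ _ (Finset.mem_univ i), if_pos rfl,
    Finset.prod_eq_one fun l hl => by rw [if_neg (Finset.ne_of_mem_erase hl), h1], mul_one]

/-- One mollification averages over shifts of at most `h` per coordinate, so `j` of them see only
the cube of half-side `j * h`. -/
theorem mollify_eq_of_eq_on_cube {φ : EuclideanSpace ℝ (Fin d) → ℝ} (hφ : IsMollifier φ volume)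
    {h : ℝ} (hs : ∀ t, φ t ≠ 0 → ∀ l, |t l| ≤ h) {g : EuclideanSpace ℝ (Fin d) → ℝ} {c : ℝ}
    {x : EuclideanSpace ℝ (Fin d)} {j : ℕ} (hg : ∀ y ∈ cube x (j * h), g y = c) :
    (mollify φ volume)^[j] g x = c := by
  -- The margin `ρ` makes the induction work: each step needs constancy on a whole cube, not at a
  -- point.
  have key : ∀ (j : ℕ) (ρ : ℝ) (g : EuclideanSpace ℝ (Fin d) → ℝ),
      (∀ y ∈ cube x (ρ + j * h), g y = c) →
        ∀ y ∈ cube x ρ, (mollify φ volume)^[j] g y = c := by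
    intro j
    induction j with
    | zero => intro ρ g hg y hy; exact hg y (by simpa using hy)
    | succ j ih =>
      intro ρ g hg y hy
      refine ih ρ _ (fun z hz => ?_) y hy
      have : ∀ t, φ t • g (z - t) = φ t * c := fun t => by
        by_cases ht : φ t = 0
        · simp [ht]
        · rw [hg (z - t) fun l => ?_, smul_eq_mul]
          have h1 := hs t ht l
          have h2 := hz l
          rw [PiLp.sub_apply, show z l - t l - x l = (z l - x l) - t l by ring]
          refine (abs_sub _ _).trans ?_
          push_cast
          linarith
      rw [mollify_apply, integral_congr_ae (ae_of_all _ this), integral_mul_const,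
        hφ.integral_eq_one, one_mul]
  exact key j 0 g (by simpa using hg) x fun l => by simp

theorem iterate_mollify_nonneg {φ : EuclideanSpace ℝ (Fin d) → ℝ} (hφ : IsMollifier φ volume)
    {g : EuclideanSpace ℝ (Fin d) → ℝ} (hg : ∀ x, 0 ≤ g x) (j : ℕ)
    (x : EuclideanSpace ℝ (Fin d)) : 0 ≤ (mollify φ volume)^[j] g x := by
  induction j generalizing g with
  | zero => exact hg x
  | succ j ih => exact ih fun z => integral_nonneg fun t => mul_nonneg (hφ.nonneg t) (hg _)

end Cube

/-! ### Fooling functions and the lower bound on `n` -/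

section Fooling

open scoped ContDiff

theorem exists_smooth_cover (k : ℕ) : ∃ C : ℝ, 1 ≤ C ∧
    ∀ {d n : ℕ} (x : Fin n → EuclideanSpace ℝ (Fin d)), 1 ≤ d →
      ∃ u : EuclideanSpace ℝ (Fin d) → ℝ, ContDiff ℝ ∞ u ∧ (∀ y, 0 ≤ u y ∧ u y ≤ 1) ∧
        (∀ i, u (x i) = 1) ∧ (∀ y, y ∉ ⋃ i, cube (x i) (1 / 8) → u y = 0) ∧
        ∀ j ≤ k, ∀ y, ‖iteratedFDeriv ℝ (j + 1) u y‖ ≤ (C * d) ^ (k + 1) := by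
  -- With this kernel width, `k + 1` mollifications spread by `1/16` in total: cubes of half-side
  -- `1/16` leave the value `1` at their centers, and the support stays within half-side `1/8`.
  have hh : (0 : ℝ) < 1 / (16 * (k + 1)) := by positivity
  let b : ContDiffBump (0 : ℝ) :=
    ⟨1 / (16 * (k + 1)) / 2, 1 / (16 * (k + 1)), half_pos hh, half_lt_self hh⟩
  set h : ℝ := 1 / (16 * (k + 1)) with h_def
  have hkh : ((k + 1 : ℕ) : ℝ) * h = 1 / 16 := by
    rw [h_def]; push_cast; field_simp
  set η : ℝ → ℝ := b.normed volume with η_def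
  have h0 : ∀ t, 0 ≤ η t := fun t => b.nonneg_normed t
  have hs : ContDiff ℝ ∞ η := b.contDiff_normed
  have hη : ∀ t, η t ≠ 0 → |t| ≤ h := fun t ht => by
    have : t ∈ Function.support (b.normed volume) := ht
    rw [b.support_normed_eq, Metric.mem_ball, Real.dist_eq, sub_zero] at this
    exact this.le
  have h1 : ∫ t, η t = 1 := b.integral_normed
  refine ⟨max 1 (∫ t, |deriv η t|), le_max_left _ _, fun {d n} x hd => ?_⟩
  have hφ : IsMollifier (productKernel d η) volume := isMollifier_productKernel h0 hs hη h1
  have hsupp : ∀ t, productKernel d η t ≠ 0 → ∀ l, |t l| ≤ h :=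
    fun t ht l => productKernel_support hη ht l
  set K : Set (EuclideanSpace ℝ (Fin d)) := ⋃ i, cube (x i) (1 / 16) with K_def
  have hK : IsCompact K := isCompact_iUnion fun i => isCompact_cube _ _
  set g : EuclideanSpace ℝ (Fin d) → ℝ := K.indicator 1 with g_def
  have hg0 : ∀ y, 0 ≤ g y := fun y => Set.indicator_nonneg (fun _ _ => zero_le_one) y
  have hg1 : ∀ y, ‖g y‖ ≤ 1 := fun y => by
    by_cases hy : y ∈ K <;> simp [g_def, hy]
  have hgi : LocallyIntegrable g volume :=
    ((integrable_indicator_iff hK.measurableSet).2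
      (integrableOn_const hK.measure_lt_top.ne)).locallyIntegrable
  have hgs : HasCompactSupport g := HasCompactSupport.intro hK fun y hy => by simp [g_def, hy]
  refine ⟨(mollify (productKernel d η) volume)^[k + 1] g, ?_, fun y => ⟨?_, ?_⟩, fun i => ?_,
    fun y hy => ?_, fun j hj y => ?_⟩
  · rw [Function.iterate_succ_apply]
    exact contDiff_iterate_mollify hφ (contDiff_mollify hφ hgi) k
  · exact iterate_mollify_nonneg hφ hg0 _ _
  · exact (le_abs_self _).trans (norm_iterate_mollify_le hφ hg1 _ _)
  · refine mollify_eq_of_eq_on_cube hφ hsupp fun y hy => ?_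
    rw [hkh] at hy
    exact Set.indicator_of_mem (Set.mem_iUnion.2 ⟨i, hy⟩) _
  · refine mollify_eq_of_eq_on_cube hφ hsupp fun z hz => ?_
    rw [hkh] at hz
    refine Set.indicator_of_notMem (fun hzK => hy ?_) _
    obtain ⟨i, hi⟩ := Set.mem_iUnion.1 hzK
    refine Set.mem_iUnion.2 ⟨i, fun l => ?_⟩
    have h2 := abs_sub_le (y l) (z l) (x i l)
    have h3 := hz l
    have h4 := hi l
    rw [abs_sub_comm] at h3
    linarith
  · refine (norm_iteratedFDeriv_iterate_mollify_le hφ (j + 1) hgi hgs hg1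
      (Nat.succ_le_succ hj) y).trans ?_
    have hd' : (1 : ℝ) ≤ d := by exact_mod_cast hd
    have hM : ∫ t, ‖fderiv ℝ (productKernel d η) t‖ ≤ max 1 (∫ t, |deriv η t|) * d := by
      refine (integral_norm_fderiv_productKernel_le h0 hs hη h1).trans ?_
      rw [mul_comm]
      gcongr
      exact le_max_right _ _
    rw [mul_one]
    exact (pow_le_pow_left₀ (integral_nonneg fun _ => norm_nonneg _) hM _).trans
      (pow_le_pow_right₀ (one_le_mul_of_one_le_of_one_le (le_max_left _ _) hd') (by omega))

namespace AdaptiveAlgorithm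

variable {d n : ℕ} {D : Set (EuclideanSpace ℝ (Fin d))}

theorem values_eq_values_zero (A : AdaptiveAlgorithm D n) {f : D → ℝ}
    (hf : ∀ i < n, f (A.node i (A.values 0 i)) = 0) : ∀ i ≤ n, A.values f i = A.values 0 i
  | 0, _ => rfl
  | i + 1, hi => by
    rw [values, values, A.values_eq_values_zero hf i (by omega), hf i (by omega), Pi.zero_apply]

/-- The outputs on `f` and `-f` both equal the output on `0`, which must approximate two opposite
integrals. -/
theorem integral_le_of_error_le (A : AdaptiveAlgorithm D n) {F : Set (D → ℝ)} {f : D → ℝ} {ε : ℝ}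
    (hε : 0 ≤ ε) (hA : A.error F ≤ ENNReal.ofReal ε) (hfF : f ∈ F) (hfF' : -f ∈ F)
    (hf : ∀ i < n, f (A.node i (A.values 0 i)) = 0) :
    ∫ x, f x ∂(volume.comap ((↑) : D → EuclideanSpace ℝ (Fin d))) ≤ ε := by
  have key : ∀ g ∈ F, (∀ i < n, g (A.node i (A.values 0 i)) = 0) →
      |(∫ x, g x ∂(volume.comap ((↑) : D → EuclideanSpace ℝ (Fin d)))) - A.output 0| ≤ ε := by
    intro g hgF hg
    rw [← ENNReal.ofReal_le_ofReal_iff hε, output, ← A.values_eq_values_zero hg n le_rfl]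
    exact (le_iSup₂ (f := fun (f : D → ℝ) (_ : f ∈ F) => ENNReal.ofReal
      |(∫ x, f x ∂(volume.comap ((↑) : D → EuclideanSpace ℝ (Fin d)))) - A.output f|)
      g hgF).trans hA
  have h1 := abs_le.1 (key f hfF hf)
  have h2 := abs_le.1 (key (-f) hfF' fun i hi => by rw [Pi.neg_apply, hf i hi, neg_zero])
  simp only [Pi.neg_apply, integral_neg] at h2
  linarith [h1.2, h2.1]

end AdaptiveAlgorithm

theorem smoothClassBar_subset_smoothClass {d : ℕ} {D : Set (EuclideanSpace ℝ (Fin d))}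
    (hD : IsOpen D) (k : ℕ) (L : ℕ → ℝ) : smoothClassBar D k L ⊆ smoothClass D k L := by
  rintro g ⟨f, rfl, hf, hb, hl⟩
  refine ⟨f, rfl, hf.contDiffOn, fun x _ => hb x, fun j hj x hx y hy => ?_⟩
  rw [iteratedFDerivWithin_of_isOpen j hD hx, iteratedFDerivWithin_of_isOpen j hD hy]
  exact hl j hj x y

theorem mem_smoothClassBar {d : ℕ} {D : Set (EuclideanSpace ℝ (Fin d))} {k : ℕ} {L : ℕ → ℝ}
    {f : EuclideanSpace ℝ (Fin d) → ℝ} (hf : ContDiff ℝ ∞ f) (hb : ∀ x, |f x| ≤ 1)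
    (hL : ∀ j ≤ k, ∀ x, ‖iteratedFDeriv ℝ (j + 1) f x‖ ≤ L j) :
    (fun x : D => f x) ∈ smoothClassBar D k L := by
  refine ⟨f, rfl, hf.of_le (by exact_mod_cast le_top), hb, fun j hj x y => ?_⟩
  refine Convex.norm_image_sub_le_of_norm_fderiv_le (𝕜 := ℝ) (s := Set.univ)
    (fun z _ => hf.differentiable_iteratedFDeriv (by exact_mod_cast ENat.natCast_lt_top j) z)
    (fun z _ => ?_) convex_univ (Set.mem_univ _) (Set.mem_univ _)
  rw [norm_fderiv_iteratedFDeriv]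
  exact hL j hj z

theorem norm_iteratedFDeriv_succ_const_sub {E : Type*} [NormedAddCommGroup E] [NormedSpace ℝ E]
    {u : E → ℝ} (hu : ContDiff ℝ ∞ u) (a c : ℝ) (j : ℕ) (x : E) :
    ‖iteratedFDeriv ℝ (j + 1) (fun y => c - a * u y) x‖ =
      |a| * ‖iteratedFDeriv ℝ (j + 1) u x‖ := by
  have : fderiv ℝ (fun y => c - a * u y) = (-a) • fderiv ℝ u := by
    ext1 y
    rw [fderiv_const_sub, fderiv_const_mul ((hu.differentiable (by simp)) y), Pi.smul_apply,
      neg_smul]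
  rw [← norm_iteratedFDeriv_fderiv, this, iteratedFDeriv_const_smul_apply, norm_smul, norm_neg,
    norm_iteratedFDeriv_fderiv, Real.norm_eq_abs]
  exact ((hu.fderiv_right (m := ∞) (by simp)).of_le (by exact_mod_cast le_top)).contDiffAt

theorem exists_four_pow_le_two_mul (k : ℕ) : ∃ C : ℝ, 1 ≤ C ∧
    ∀ {d n : ℕ} {D : Set (EuclideanSpace ℝ (Fin d))} {L : ℕ → ℝ} {a : ℝ} {F : Set (D → ℝ)}
      (A : AdaptiveAlgorithm D n), 1 ≤ d → IsOpen D → volume D = 1 → 0 < a → a ≤ 1 →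
      (∀ j ≤ k, a * (C * d) ^ (k + 1) ≤ L j) → smoothClassBar D k L ⊆ F →
      A.error F ≤ ENNReal.ofReal (a / 2) → 4 ^ d ≤ 2 * n := by
  obtain ⟨C, hC, H⟩ := exists_smooth_cover k
  refine ⟨C, hC, fun {d n D L a F} A hd hD hvol ha ha1 hL hF hA => ?_⟩
  -- Adaptivity does not help: these are also the nodes used for any input that vanishes at them.
  let x : Fin n → EuclideanSpace ℝ (Fin d) := fun i => (A.node i (A.values 0 i) : _)
  obtain ⟨u, hu, hu01, hux, hu0, hud⟩ := H x hd
  have hmem : ∀ b : ℝ, |b| = a → (fun y : D => b - b * u y) ∈ F := fun b hb => by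
    refine hF (mem_smoothClassBar (f := fun y => b - b * u y)
      (contDiff_const.sub (contDiff_const.mul hu)) (fun y => ?_) fun j hj y => ?_)
    · have h1 := hu01 y
      rw [show b - b * u y = b * (1 - u y) by ring, abs_mul, hb,
        abs_of_nonneg (by linarith : (0 : ℝ) ≤ 1 - u y)]
      nlinarith
    · rw [norm_iteratedFDeriv_succ_const_sub hu, hb]
      exact (mul_le_mul_of_nonneg_left (hud j hj y) ha.le).trans (hL j hj)
  have hint := A.integral_le_of_error_le (by positivity) hA (hmem a (abs_of_pos ha))
    (by
      have := hmem (-a) (by rw [abs_neg, abs_of_pos ha])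
      convert this using 1
      ext y
      simp only [Pi.neg_apply]
      ring)
    (fun i hi => by
      have := hux ⟨i, hi⟩
      simp only [x] at this
      simp [this])
  rw [integral_subtype_comap hD.measurableSet (fun y => a - a * u y)] at hint
  set U : Set (EuclideanSpace ℝ (Fin d)) := ⋃ i, cube (x i) (1 / 8) with U_def
  have hUm : MeasurableSet U := MeasurableSet.iUnion fun i => (isClosed_cube _ _).measurableSet
  have hUv : volume U ≤ ENNReal.ofReal (n * (1 / 4) ^ d) := by
    refine (measure_iUnion_le _).trans ?_
    simp only [volume_cube, tsum_fintype, Finset.sum_const, Finset.card_univ, Fintype.card_fin,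
      nsmul_eq_mul]
    rw [ENNReal.ofReal_mul (p := (n : ℝ)) (by positivity), ENNReal.ofReal_natCast,
      ENNReal.ofReal_pow (by norm_num), show (2 : ℝ) * (1 / 8) = 1 / 4 by norm_num]
  have hDf : IsFiniteMeasure (volume.restrict D) := ⟨by simp [hvol]⟩
  have hUr : (volume.restrict D).real U ≤ n * (1 / 4) ^ d :=
    ENNReal.toReal_le_of_le_ofReal (by positivity) ((Measure.restrict_apply_le _ _).trans hUv)
  have hui : Integrable u (volume.restrict D) :=
    Integrable.of_bound hu.continuous.aestronglyMeasurable 1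
      (ae_of_all _ fun y => by rw [Real.norm_of_nonneg (hu01 y).1]; exact (hu01 y).2)
  have hule : ∫ y in D, u y ≤ n * (1 / 4) ^ d := by
    refine le_trans ?_ hUr
    rw [← integral_indicator_one hUm]
    refine integral_mono hui ((integrable_const 1).indicator hUm) fun y => ?_
    by_cases hy : y ∈ U
    · simpa [hy] using (hu01 y).2
    · simp [hy, hu0 y hy]
  rw [integral_sub (integrable_const a) (hui.const_mul a), integral_const_mul, integral_const,
    measureReal_restrict_apply_univ, measureReal_def, hvol, ENNReal.toReal_one, one_smul] at hint
  have h3 : (1 : ℝ) / 2 ≤ n * (1 / 4) ^ d := by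
    nlinarith [mul_le_mul_of_nonneg_left hule ha.le]
  have h4 : ((4 : ℝ)) ^ d ≤ 2 * n := by
    rw [one_div_pow, mul_one_div, le_div_iff₀ (by positivity)] at h3
    linarith
  exact_mod_cast h4

end Fooling

/-! ### From exponential complexity to intractability -/

section Tractability

theorem two_pow_le_infoComplexity {d : ℕ} (hd : 1 ≤ d) {D : Set (EuclideanSpace ℝ (Fin d))}
    {ε : ℝ} {F : Set (D → ℝ)}
    (h : ∀ (n : ℕ) (A : AdaptiveAlgorithm D n), A.error F ≤ ENNReal.ofReal ε → 4 ^ d ≤ 2 * n) :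
    ((2 ^ d : ℕ) : ℕ∞) ≤ infoComplexity ε F := by
  refine le_iInf₂ fun n ⟨A, hA⟩ => ?_
  have h1 := h n A hA
  have h2 : 2 ≤ 2 ^ d := le_self_pow₀ one_le_two (by omega)
  rw [show 4 = 2 * 2 from rfl, mul_pow] at h1
  have : 2 ^ d ≤ n := by nlinarith
  exact_mod_cast this

theorem natCast_mul_log_two_le_log {d : ℕ} {N : ℕ∞} (h : ((2 ^ d : ℕ) : ℕ∞) ≤ N) :
    ((d * Real.log 2 : ℝ) : EReal) ≤ ENNReal.log (max 1 (N : ℝ≥0∞)) := by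
  have h1 : ENNReal.ofReal (2 ^ d) ≤ max 1 (N : ℝ≥0∞) := by
    refine le_max_of_le_right ?_
    rw [ENNReal.ofReal_pow (by norm_num), ENNReal.ofReal_ofNat]
    exact_mod_cast ENat.toENNReal_le.2 h
  refine le_trans (le_of_eq ?_) (ENNReal.log_monotone h1)
  rw [ENNReal.log_ofReal_of_pos (by positivity), Real.log_pow]

theorem exists_frequently_le {k : ℕ} {L : ℕ → ℕ → ℝ} {m : ℝ}
    (hL : 0 < limsup (fun d : ℕ => ⨅ j : Fin (k + 1), ((L j d * (d : ℝ) ^ m : ℝ) : EReal)) atTop) :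
    ∃ c : ℝ, 0 < c ∧ c ≤ 1 ∧ ∃ s : ℝ, 0 ≤ s ∧
      ∃ᶠ d : ℕ in atTop, ∀ j ≤ k, c * (d : ℝ) ^ (-s) ≤ L j d := by
  obtain ⟨c, hc0, hc⟩ := EReal.lt_iff_exists_real_btwn.1 hL
  have hc0' : 0 < c := by exact_mod_cast hc0
  -- Truncating both constants keeps `c * d ^ (-s) ≤ 1`, so amplitudes stay at most `1` and errors
  -- below `1`.
  refine ⟨min c 1, lt_min hc0' one_pos, min_le_right _ _, max m 0, le_max_right _ _, ?_⟩
  refine ((frequently_lt_of_lt_limsup (by isBoundedDefault) hc).and_eventually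
    (eventually_ge_atTop 1)).mono fun d hd j hj => ?_
  obtain ⟨hd, hd1⟩ := hd
  have hd1' : (1 : ℝ) ≤ d := by exact_mod_cast hd1
  have h1 : c < L j d * (d : ℝ) ^ m := by
    exact_mod_cast hd.trans_le (iInf_le _ (⟨j, Nat.lt_succ_of_le hj⟩ : Fin (k + 1)))
  have h2 : c * (d : ℝ) ^ (-m) ≤ L j d := by
    rw [Real.rpow_neg (by positivity), ← div_eq_mul_inv, div_le_iff₀ (by positivity)]
    exact h1.le
  refine le_trans ?_ h2
  gcongr
  · exact min_le_left _ _
  · exact le_max_left _ _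

theorem not_uniformlyWeaklyTractable {D : (d : ℕ) → Set (EuclideanSpace ℝ (Fin d))}
    {F : (d : ℕ) → Set (D d → ℝ)} {c s : ℝ} (hc0 : 0 < c) (hc1 : c ≤ 1) (hs : 0 ≤ s)
    (h : ∃ᶠ d : ℕ in atTop,
      ((2 ^ d : ℕ) : ℕ∞) ≤ infoComplexity (c * (d : ℝ) ^ (-s) / 2) (F d)) :
    ¬ UniformlyWeaklyTractable F := by
  intro hT
  -- This choice gives `α < 1` and `s * α ≤ 1`, so `ε ^ (-α)` grows at most linearly in `d`.
  set α : ℝ := 1 / (s + 2) with hα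
  have hα0 : 0 < α := by positivity
  have hα1 : α < 1 := by rw [hα, div_lt_one (by positivity)]; linarith
  have hsα : s * α ≤ 1 := by
    rw [hα, mul_one_div, div_le_one (by positivity)]; linarith
  set ε : ℕ → ℝ := fun d => c * (d : ℝ) ^ (-s) / 2 with hε
  have hε0 : ∀ d : ℕ, 1 ≤ d → 0 < ε d := fun d hd => by
    have : (0 : ℝ) < d := by exact_mod_cast hd
    positivity
  have hε1 : ∀ d : ℕ, 1 ≤ d → ε d < 1 := fun d hd => by
    have hd' : (1 : ℝ) ≤ d := by exact_mod_cast hd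
    have h1 : (d : ℝ) ^ (-s) ≤ 1 := Real.rpow_le_one_of_one_le_of_nonpos hd' (by linarith)
    have h2 : c * (d : ℝ) ^ (-s) ≤ 1 := mul_le_one₀ hc1 (by positivity) h1
    simp only [hε]
    linarith
  have htend : Tendsto (fun d : ℕ => (d, ε d)) atTop
      (comap (fun p : ℕ × ℝ => (p.1 : ℝ) + p.2⁻¹) atTop ⊓
        𝓟 {p : ℕ × ℝ | 1 ≤ p.1 ∧ 0 < p.2 ∧ p.2 < 1}) := by
    refine tendsto_inf.2 ⟨tendsto_comap_iff.2 ?_, tendsto_principal.2 ?_⟩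
    · refine tendsto_atTop_mono' _ ?_ tendsto_natCast_atTop_atTop
      filter_upwards [eventually_ge_atTop 1] with d hd
      have := inv_pos.2 (hε0 d hd)
      simp only [Function.comp_apply]
      linarith
    · filter_upwards [eventually_ge_atTop 1] with d hd
      exact ⟨hd, hε0 d hd, hε1 d hd⟩
  set K : ℝ := 1 + (c / 2) ^ (-α) with hK
  have hK0 : 0 < K := by positivity
  have hlog : 0 < Real.log 2 := Real.log_pos one_lt_two
  have hev := ((hT α hα0 hα1).comp htend).eventually_lt_const
    (u := ((Real.log 2 / K : ℝ) : EReal)) (by exact_mod_cast div_pos hlog hK0)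
  obtain ⟨d, hd, hlt, hd1⟩ := (h.and_eventually (hev.and (eventually_ge_atTop 1))).exists
  refine absurd hlt (not_lt.2 ?_)
  have hd' : (1 : ℝ) ≤ d := by exact_mod_cast hd1
  have hd0 : (0 : ℝ) < d := by linarith
  have hden0 : 0 < (d : ℝ) ^ α + ε d ^ (-α) := by
    have := hε0 d hd1
    positivity
  have hden : (d : ℝ) ^ α + ε d ^ (-α) ≤ K * d := by
    have h1 : (d : ℝ) ^ α ≤ d := by
      simpa using Real.rpow_le_rpow_of_exponent_le hd' hα1.le
    have h2 : ε d ^ (-α) = (c / 2) ^ (-α) * (d : ℝ) ^ (s * α) := by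
      rw [show ε d = c / 2 * (d : ℝ) ^ (-s) by simp only [hε]; ring,
        Real.mul_rpow (by positivity) (by positivity), ← Real.rpow_mul hd0.le, neg_mul_neg]
    have h3 : (d : ℝ) ^ (s * α) ≤ d := by
      simpa using Real.rpow_le_rpow_of_exponent_le hd' hsα
    rw [h2, hK, add_mul, one_mul]
    gcongr
  simp only [Function.comp_apply]
  rw [EReal.le_div_iff_mul_le (by exact_mod_cast hden0) (EReal.coe_ne_top _)]
  refine le_trans ?_ (natCast_mul_log_two_le_log hd)
  rw [← EReal.coe_mul, EReal.coe_le_coe_iff, div_mul_eq_mul_div, div_le_iff₀ hK0]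
  nlinarith

end Tractability

theorem mainTheorem12
    (D : (d : ℕ) → Set (EuclideanSpace ℝ (Fin d)))
    (hDopen : ∀ d, 1 ≤ d → IsOpen (D d))
    (hDvol : ∀ d, 1 ≤ d → volume (D d) = 1)
    (k : ℕ) (L : ℕ → ℕ → ℝ)
    (hLpos : ∀ j ≤ k, ∀ d, 1 ≤ d → 0 < L j d)
    (m : ℝ)
    (hL : 0 < limsup (fun d : ℕ => ⨅ j : Fin (k + 1), ((L j d * (d : ℝ) ^ m : ℝ) : EReal)) atTop) :
    ¬ UniformlyWeaklyTractable (fun d => smoothClassBar (D d) k (fun j => L j d)) ∧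
    ¬ UniformlyWeaklyTractable (fun d => smoothClass (D d) k (fun j => L j d)) := by
  obtain ⟨c, hc0, hc1, s, hs, hfreq⟩ := exists_frequently_le hL
  obtain ⟨C, hC, H⟩ := exists_four_pow_le_two_mul k
  have main : ∀ F : (d : ℕ) → Set (D d → ℝ),
      (∀ d, 1 ≤ d → smoothClassBar (D d) k (fun j => L j d) ⊆ F d) →
        ¬ UniformlyWeaklyTractable F := by
    intro F hF
    have hCp : (1 : ℝ) ≤ C ^ (k + 1) := one_le_pow₀ hC
    have hc'1 : c / C ^ (k + 1) ≤ 1 := (div_le_one (by positivity)).2 (hc1.trans hCp)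
    have hs' : 0 ≤ s + (k + 1 : ℕ) := by positivity
    -- The extra factor `(C * d) ^ (-(k + 1))` cancels the derivative bound of the fooling function.
    refine not_uniformlyWeaklyTractable (c := c / C ^ (k + 1)) (s := s + (k + 1 : ℕ))
      (by positivity) hc'1 hs' ?_
    refine (hfreq.and_eventually (eventually_ge_atTop 1)).mono fun d hd => ?_
    obtain ⟨hd, hd1⟩ := hd
    have hd' : (1 : ℝ) ≤ d := by exact_mod_cast hd1
    have hd0 : (0 : ℝ) < d := by linarith
    refine two_pow_le_infoComplexity hd1 fun n A hA =>
      H A hd1 (hDopen d hd1) (hDvol d hd1) (by positivity) ?_ (fun j hj => ?_) (hF d hd1) hA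
    · exact mul_le_one₀ hc'1 (by positivity)
        (Real.rpow_le_one_of_one_le_of_nonpos hd' (by linarith))
    · refine le_trans (le_of_eq ?_) (hd j hj)
      rw [neg_add, Real.rpow_add hd0, Real.rpow_neg hd0.le ((k + 1 : ℕ) : ℝ), Real.rpow_natCast,
        mul_pow]
      field_simp
  exact ⟨main _ fun d _ => subset_rfl,
    main _ fun d hd => smoothClassBar_subset_smoothClass (hDopen d hd) k _⟩
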